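/- Let $\mathcal M=(\mathcal S,Act,T,\kappa_0)$ be a finite Markov decision process with transition function $T(s'\mid s,\alpha)$ and initial distribution $\kappa_0$, let $\gamma\in(0,1)$, let $c:\mathcal S\times Act\to[0,\infty)$ be a cost and $d^i:\mathcal S\times Act\to[0,\infty)$, $i=1,\dots,n_c$, constraint costs with budgets $\beta^i>0$. A (history-dependent, randomized) policy $\pi$ and $\kappa_0$ determine the law $\mathbb P^\pi_{\kappa_0}$ of the state-action process $(s_0,\alpha_0,s_1,\alpha_1,\dots)$. Take as one-step risk measures the conditional expectations $\rho_t(\cdot)=\mathbb E[\,\cdot\mid s_t,\alpha_t]$, $t\ge 1$, with $\rho_0=\mathbb E$ the expectation under $\mathbb P^\pi_{\kappa_0}$, and for a cost function $f$ put $$\rho^\gamma_\pi(f)=\lim_{N\to\infty}\rho_0\Big(f(s_0,\alpha_0)+\rho_1\big(\gamma f(s_1,\alpha_1)+\cdots+\rho_N(\gamma^N f(s_N,\alpha_N))\cdots\big)\Big).$$ Let $\Pi$ be a class of policies containing all stationary randomized policies (for example, all policies), and let $$J_\gamma(\kappa_0)=\inf\{\rho^\gamma_\pi(c)\;:\;\pi\in\Pi,\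 \rho^\gamma_\pi(d^i)\le\beta^i,\ i=1,\dots,n_c\}\in(-\infty,+\infty]$$ (with $\inf\emptyset=+\infty$). Then: (0) The limits defining $\rho^\gamma_\pi(c)$ and $\rho^\gamma_\pi(d^i)$ exist for every policy $\pi$, and $\sigma(v,s,p)=\sum_{s'\in\mathcal S}v(s')\,p(s')$ is the risk transition mapping of the conditional expectation: $\mathbb E[v(s_{t+1})\mid s_t,\alpha_t]=\sigma(v,s_t,T(\cdot\mid s_t,\alpha_t))$ $\mathbb P^\pi_{\kappa_0}$-almost surely, for every policy $\pi$, $t\ge 0$ and $v:\mathcal S\to\mathbb R$. (1) Every optimal solution $(V^*,\lambda^*)$ of the optimization problem $$\sup_{V\in\mathbb R^{\mathcal S},\ \lambda\in\mathbb R^{n_c},\ \lambda\succeq 0}\ \langle\kappa_0,V\rangle-\langle\lambda,\beta\rangle\quad\text{subject to}\quad V(s)\le c(s,\alpha)+\sum_{i}\lambda_i d^i(s,\alpha)+\gamma\,\sigma\big(V,s,T(\cdot\mid s,\alpha)\big)\quad\forall s\in\mathcal S,\ \forall\alpha\in Act$$ satisfies $$J_\gamma(\kappa_0)=\langle\kappa_0,V^*\rangle-\langle\lambda^*,\beta\rangle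 .$$ (2) This optimization problem is a linear program: it has finitely many real variables, a linear objective, and finitely many inequality constraints that are affine in $(V,\lambda)$. -/

import Mathlib

open MeasureTheory ProbabilityTheory Filter Topology

noncomputable section

/-! ### Nested (dynamic) risk functionals -/

/-- The nested evaluation
`ρ_t (x_t + ρ_{t+1} (x_{t+1} + ⋯ + ρ_{t+k} (x_{t+k}) ⋯ ))`,
given by recursion on the number `k` of remaining stages. -/
def nestedTail {Ω : Type*} (ρ : ℕ → (Ω → ℝ) → Ω → ℝ) (x : ℕ → Ω → ℝ) : ℕ → ℕ → Ω → ℝ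
  | 0, t => ρ t (x t)
  | k + 1, t => ρ t (fun ω => x t ω + nestedTail ρ x k (t + 1) ω)

/-- `ρ^γ_{0,N}(c_0, …, c_N) = ρ_0 (c_0 + ρ_1 (γ c_1 + ρ_2 (γ² c_2 + ⋯ + ρ_N (γ^N c_N) ⋯ )))`.
The outermost mapping `ρ_0` is real-valued (nothing is known at the root);
the one-step mappings `ρ t` are used for `t ≥ 1` only. -/
def discountedRisk {Ω : Type*} (ρ₀ : (Ω → ℝ) → ℝ) (ρ : ℕ → (Ω → ℝ) → Ω → ℝ) (γ : ℝ)
    (c : ℕ → Ω → ℝ) : ℕ → ℝ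
  | 0 => ρ₀ (c 0)
  | k + 1 => ρ₀ (fun ω => c 0 ω + nestedTail ρ (fun t ω' => γ ^ t * c t ω') k 1 ω)

/-- The total discounted risk `ρ^γ(c) = lim_{N → ∞} ρ^γ_{0,N}(c_0, …, c_N)`. -/
def totalDiscountedRisk {Ω : Type*} (ρ₀ : (Ω → ℝ) → ℝ) (ρ : ℕ → (Ω → ℝ) → Ω → ℝ) (γ : ℝ)
    (c : ℕ → Ω → ℝ) : ℝ :=
  limUnder atTop (discountedRisk ρ₀ ρ γ c)

/-! ### Optimization problems with inequality constraints -/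

/-- The problem of maximizing `objective x` over `x : E`
subject to `lhs k x ≤ rhs k x` for all `k : K`. -/
structure MaxProgram (E K : Type*) where
  objective : E → ℝ
  lhs : K → E → ℝ
  rhs : K → E → ℝ

namespace MaxProgram

variable {E K : Type*}

def feasibleSet (P : MaxProgram E K) : Set E :=
  {x | ∀ k, P.lhs k x ≤ P.rhs k x}

/-- `x` is a solution: it is feasible and maximizes the objective among the feasible points. -/
def IsSolution (P : MaxProgram E K) (x : E) : Prop :=
  x ∈ P.feasibleSet ∧ ∀ y ∈ P.feasibleSet, P.objective y ≤ P.objective x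

/-- A linear program: finitely many real variables, a linear objective, and finitely many
inequality constraints between affine functions of the variables. -/
def IsLinear [AddCommGroup E] [Module ℝ E] (P : MaxProgram E K) : Prop :=
  FiniteDimensional ℝ E ∧ Finite K ∧
    (∃ f : E →ₗ[ℝ] ℝ, ∀ x, P.objective x = f x) ∧
    ∀ k, (∃ f : E →ᵃ[ℝ] ℝ, ∀ x, P.lhs k x = f x) ∧ (∃ f : E →ᵃ[ℝ] ℝ, ∀ x, P.rhs k x = f x)

end MaxProgram

/-! ### Finite Markov decision processes -/

/-- An MDP with state space `S`, action space `Act`, transition function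
`T s α = T(· | s, α)` and initial distribution `κ₀`. -/
structure MDP (S Act : Type*) where
  T : S → Act → PMF S
  κ₀ : PMF S

/-- A (history-dependent, randomized) policy: at time `t`, given the past
`(s_0, α_0), …, (s_{t-1}, α_{t-1})` and the present state `s_t`, it is a distribution
over the action `α_t`. -/
def Policy (S Act : Type*) :=
  (t : ℕ) → (Fin t → S × Act) → S → PMF Act

/-- A policy is stationary if the action distribution depends on the present state only. -/
def Policy.IsStationary {S Act : Type*} (π : Policy S Act) : Prop :=
  ∃ f : S → PMF Act, ∀ t h s, π t h s = f s

namespace MDP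

variable {S Act ι : Type*} [Fintype S] [MeasurableSpace S] [DiscreteMeasurableSpace S]
  [Fintype Act] [MeasurableSpace Act] [DiscreteMeasurableSpace Act] [Fintype ι]

/-- The law of `(s_0, α_0)`: `s_0 ∼ κ₀`, then `α_0 ∼ π_0(· | s_0)`. -/
def initLaw (M : MDP S Act) (π : Policy S Act) : PMF (S × Act) :=
  M.κ₀.bind fun s => (π 0 (fun i => i.elim0) s).map (Prod.mk s)

/-- The law of `(s_{t+1}, α_{t+1})` given the history `h = (s_0, α_0, …, s_t, α_t)`:
`s_{t+1} ∼ T(· | s_t, α_t)`, then `α_{t+1} ∼ π_{t+1}(· | h, s_{t+1})`. -/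
def stepLaw (M : MDP S Act) (π : Policy S Act) (t : ℕ) (h : Finset.Iic t → S × Act) :
    PMF (S × Act) :=
  (M.T (h ⟨t, Finset.mem_Iic.2 le_rfl⟩).1 (h ⟨t, Finset.mem_Iic.2 le_rfl⟩).2).bind fun s' =>
    (π (t + 1) (fun i => h ⟨i, Finset.mem_Iic.2 (Nat.lt_succ_iff.1 i.2)⟩) s').map (Prod.mk s')

/-- `stepLaw` as a Markov kernel. -/
def stepKernel (M : MDP S Act) (π : Policy S Act) (t : ℕ) :
    Kernel (Finset.Iic t → S × Act) (S × Act) :=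
  Kernel.ofFunOfCountable fun h => (M.stepLaw π t h).toMeasure

instance (M : MDP S Act) (π : Policy S Act) (t : ℕ) : IsMarkovKernel (M.stepKernel π t) :=
  ⟨fun h => PMF.toMeasure.isProbabilityMeasure (M.stepLaw π t h)⟩

/-- The law `ℙ^π_{κ₀}` of the state-action process `ω = ((s_0, α_0), (s_1, α_1), …)`
under the policy `π`. -/
def law (M : MDP S Act) (π : Policy S Act) : Measure (ℕ → S × Act) :=
  Kernel.trajMeasure (X := fun _ => S × Act) (M.initLaw π).toMeasure (M.stepKernel π)

/-- The one-step conditional expectation `ρ_t(X) = 𝔼[X | s_t, α_t]` under the policy `π`. -/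
def condExpStep (M : MDP S Act) (π : Policy S Act) (t : ℕ) (X : (ℕ → S × Act) → ℝ) :
    (ℕ → S × Act) → ℝ :=
  (M.law π)[X | MeasurableSpace.comap (fun ω : ℕ → S × Act => ω t) inferInstance]

/-- The stage-wise cost `c(s_t, α_t)`. -/
def stageCost (c : S → Act → ℝ) (t : ℕ) (ω : ℕ → S × Act) : ℝ :=
  c (ω t).1 (ω t).2

/-- The finite-horizon nested risk `ρ^γ_{0,N}(c(s_0, α_0), …, c(s_N, α_N))` under `π`, with
`ρ_0 = 𝔼` and `ρ_t = 𝔼[· | s_t, α_t]` for `t ≥ 1`. -/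
def finiteRisk (M : MDP S Act) (γ : ℝ) (π : Policy S Act) (c : S → Act → ℝ) (N : ℕ) : ℝ :=
  discountedRisk (fun X => ∫ ω, X ω ∂(M.law π)) (M.condExpStep π) γ (stageCost c) N

/-- The `γ`-discounted dynamic risk `ρ^γ(c(s_0, α_0), c(s_1, α_1), …)` of the policy `π`, with
`ρ_0 = 𝔼` and `ρ_t = 𝔼[· | s_t, α_t]` for `t ≥ 1`. -/
def risk (M : MDP S Act) (γ : ℝ) (π : Policy S Act) (c : S → Act → ℝ) : ℝ :=
  totalDiscountedRisk (fun X => ∫ ω, X ω ∂(M.law π)) (M.condExpStep π) γ (stageCost c)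

/-- The value `J_γ(κ₀)` of the constrained problem: the infimum of the risk of `c` over those
policies in `Pol` for which the risk of each `d i` is at most `β i`.  It is an extended real,
with value `+∞` if no policy satisfies the constraints. -/
def optimalValue (M : MDP S Act) (γ : ℝ) (c : S → Act → ℝ) (d : ι → S → Act → ℝ) (β : ι → ℝ)
    (Pol : Set (Policy S Act)) : EReal :=
  ⨅ π ∈ {π ∈ Pol | ∀ i, M.risk γ π (d i) ≤ β i}, (M.risk γ π c : EReal)

/-- The optimization problem attached to a risk transition mapping `σ(v, s, p)`, in the variables
`x = (V, l)` with `V : S → ℝ` and multipliers `l : ι → ℝ`: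
maximize `⟨κ₀, V⟩ - ⟨l, β⟩` subject to
`V(s) ≤ c(s,α) + ⟨l, d(s,α)⟩ + γ σ(V, s, T(·|s,α))` for all `s, α`, and `0 ≤ l i` for all `i`. -/
def bellmanProgram (M : MDP S Act) (γ : ℝ) (c : S → Act → ℝ) (d : ι → S → Act → ℝ) (β : ι → ℝ)
    (σ : (S → ℝ) → S → PMF S → ℝ) : MaxProgram ((S → ℝ) × (ι → ℝ)) ((S × Act) ⊕ ι) where
  objective x := ∑ s, (M.κ₀ s).toReal * x.1 s - ∑ i, x.2 i * β i
  lhs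
    | .inl k => fun x => x.1 k.1
    | .inr _ => fun _ => 0
  rhs
    | .inl k => fun x => c k.1 k.2 + ∑ i, x.2 i * d i k.1 k.2 + γ * σ x.1 k.1 (M.T k.1 k.2)
    | .inr i => fun x => x.2 i

/-- The risk transition mapping of the conditional expectation:
`σ(v, s, p) = ∑_{s'} v(s') p(s')`. -/
def expectationMapping (v : S → ℝ) (_ : S) (p : PMF S) : ℝ :=
  ∑ s', v s' * (p s').toReal

end MDP

end

set_option linter.unusedSectionVars false

noncomputable section

/-! ### Farkas' lemma and linear programming duality -/

/-! Under the outer expectation, nested conditional expectations collapse by the tower property, so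
the risk is the discounted sum of expected stage costs (`hasSum_risk`) and is linear in the cost.
What remains is linear programming duality.

Lower bound on the value: feasibility of `(V, l)` makes `V` a Bellman subsolution for the Lagrangian
cost `c + ∑ i, l i * d i`. Iterating this inequality along any policy, history-dependent or not,
bounds `⟨κ₀, V⟩` by the risk of that cost (`sum_le_risk_of_le_bellman`), and the budgets bound the
penalty term.

Upper bound: if `(V, l)` is optimal, Farkas' lemma provides nonnegative multipliers `μ` of the
Bellman constraints. They form a discounted occupation measure, which satisfies the flow equation
and the budgets and costs at most the optimal value (`exists_occupationMeasure_of_isSolution`).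
Conditioning `μ` on the state gives a stationary policy whose risks are at most those predicted by
`μ` (`risk_le_of_flow`). Existence of an LP solution thus already yields an admissible policy, with
no Slater condition. -/

/-- **Farkas' lemma** for finitely many linear forms on a real vector space. -/
theorem exists_nonneg_eq_sum_smul_of_forall_nonpos {E K : Type*} [AddCommGroup E] [Module ℝ E]
    (t : Finset K) (g : K → E →ₗ[ℝ] ℝ) (f : E →ₗ[ℝ] ℝ)
    (H : ∀ x, (∀ k ∈ t, g k x ≤ 0) → f x ≤ 0) :
    ∃ u : K → ℝ, (∀ k, 0 ≤ u k) ∧ ∀ x, f x = ∑ k ∈ t, u k * g k x := by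
  classical
  induction t using Finset.induction_on generalizing g f with
  | empty =>
    refine ⟨0, fun _ => le_rfl, fun x => ?_⟩
    have h1 := H x (by simp)
    have h2 := H (-x) (by simp)
    rw [map_neg] at h2
    rw [Finset.sum_empty]
    linarith
  | insert a t ha ih =>
    have hupd : ∀ (u : K → ℝ) (r : ℝ) (x : E),
        ∑ k ∈ t, Function.update u a r k * g k x = ∑ k ∈ t, u k * g k x := fun u r x =>
      Finset.sum_congr rfl fun k hk => by
        rw [Function.update_of_ne (ne_of_mem_of_not_mem hk ha)]
    by_cases h : ∀ x, (∀ k ∈ t, g k x ≤ 0) → f x ≤ 0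
    · obtain ⟨u, hu, hf⟩ := ih g f h
      refine ⟨Function.update u a 0, fun k => ?_, fun x => ?_⟩
      · by_cases hk : k = a
        · simp [hk]
        · simpa [hk] using hu k
      · rw [Finset.sum_insert ha, hf x]
        rw [Function.update_self, zero_mul, zero_add, hupd]
    -- Constraint `a` is not redundant: some `z` satisfies the others with `f z > 0`, which forces
    -- `g a z > 0`.
    · push Not at h
      obtain ⟨z, hz, hfz⟩ := h
      have hgz : 0 < g a z := by
        by_contra! hle
        refine absurd (H z fun k hk => ?_) (not_le.2 hfz)
        rcases Finset.mem_insert.1 hk with rfl | hk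
        exacts [hle, hz k hk]
      -- Precompose every form with the projection along `z` onto the kernel of `g a`. Constraint
      -- `a` holds there with equality, so only those in `t` remain.
      obtain ⟨u, hu, hf⟩ := ih (fun k => g k - (g k z / g a z) • g a)
        (f - (f z / g a z) • g a) (fun x hx => by
          have key : ∀ l : E →ₗ[ℝ] ℝ, (l - (l z / g a z) • g a) x = l (x - (g a x / g a z) • z) := by
            intro l
            simp only [LinearMap.sub_apply, LinearMap.smul_apply, smul_eq_mul, map_sub, map_smul]
            ring
          rw [key]
          refine H _ fun k hk => ?_
          rcases Finset.mem_insert.1 hk with rfl | hk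
          · simp [hgz.ne']
          · rw [← key]; exact hx k hk)
      -- The coefficient of `g a` is forced by evaluating at `z`.
      refine ⟨Function.update u a ((f z - ∑ k ∈ t, u k * g k z) / g a z), fun k => ?_, fun x => ?_⟩
      · by_cases hk : k = a
        · subst hk
          rw [Function.update_self]
          refine div_nonneg (sub_nonneg.2 (le_trans ?_ hfz.le)) hgz.le
          exact Finset.sum_nonpos fun k hk => mul_nonpos_of_nonneg_of_nonpos (hu k) (hz k hk)
        · simpa [hk] using hu k
      · rw [Finset.sum_insert ha, Function.update_self, hupd]
        have := hf x
        simp only [LinearMap.sub_apply, LinearMap.smul_apply, smul_eq_mul, mul_sub,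
          Finset.sum_sub_distrib] at this
        have e : ∑ k ∈ t, u k * (g k z / g a z * g a x)
            = (∑ k ∈ t, u k * g k z) / g a z * g a x := by
          rw [Finset.sum_div, Finset.sum_mul]
          exact Finset.sum_congr rfl fun k _ => by ring
        rw [e] at this
        linear_combination this

/-- Strong duality for linear programs: an optimal point of `max f` subject to `g k ≤ h k` is
certified by nonnegative multipliers. -/
theorem exists_multipliers_of_isMax {E K : Type*} [AddCommGroup E] [Module ℝ E] [Fintype K]
    (f : E →ₗ[ℝ] ℝ) (g : K → E →ₗ[ℝ] ℝ) (h : K → ℝ) (x₀ : E) (hx₀ : ∀ k, g k x₀ ≤ h k)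
    (hmax : ∀ x, (∀ k, g k x ≤ h k) → f x ≤ f x₀) :
    ∃ u : K → ℝ, (∀ k, 0 ≤ u k) ∧ (∀ x, f x = ∑ k, u k * g k x) ∧ ∑ k, u k * h k ≤ f x₀ := by
  -- Homogenization: a scale variable `r` turns `g k x ≤ h k` into `g k x ≤ h k * r`, and the index
  -- `none` encodes `0 ≤ r`.
  let G : Option K → E × ℝ →ₗ[ℝ] ℝ := fun o =>
    o.elim (-LinearMap.snd ℝ E ℝ)
      (fun k => (g k).comp (LinearMap.fst ℝ E ℝ) - h k • LinearMap.snd ℝ E ℝ)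
  obtain ⟨u, hu, hf⟩ := exists_nonneg_eq_sum_smul_of_forall_nonpos Finset.univ G
    (f.comp (LinearMap.fst ℝ E ℝ) - f x₀ • LinearMap.snd ℝ E ℝ) (by
      rintro ⟨x, r⟩ hx
      have hr : 0 ≤ r := by simpa [G] using hx none (Finset.mem_univ _)
      have hg : ∀ k, g k x ≤ h k * r := fun k => by
        simpa [G] using hx (some k) (Finset.mem_univ _)
      suffices f x ≤ f x₀ * r by simpa using this
      -- For `r = 0`, `x` is a recession direction, so `x₀ + x` is feasible; for `r > 0`, rescaling
      -- makes `r⁻¹ • x` feasible.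
      rcases hr.eq_or_lt with rfl | hr
      · have := hmax (x₀ + x) fun k => by
          have := hg k
          rw [map_add]
          linarith [hx₀ k]
        rw [map_add] at this
        linarith
      · have := hmax (r⁻¹ • x) fun k => by
          rw [map_smul, smul_eq_mul, inv_mul_le_iff₀ hr, mul_comm]
          exact hg k
        rwa [map_smul, smul_eq_mul, inv_mul_le_iff₀ hr, mul_comm] at this)
  refine ⟨fun k => u (some k), fun k => hu _, fun x => ?_, ?_⟩
  · simpa [G, Fintype.sum_option] using hf (x, 0)
  -- The multiplier `u none` is the gap between the two sides.
  · have := hf (0, 1)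
    simp [G, Fintype.sum_option] at this
    have := hu none
    linarith

/-! ### Expectations under probability mass functions on finite types -/

theorem PMF.sum_toReal {α : Type*} [Fintype α] (p : PMF α) : ∑ a, (p a).toReal = 1 := by
  rw [← ENNReal.toReal_sum fun a _ => p.apply_ne_top a, ← tsum_fintype (L := .unconditional _),
    p.tsum_coe, ENNReal.toReal_one]

theorem PMF.integral_eq_sum_mul {α : Type*} [Fintype α] [MeasurableSpace α]
    [DiscreteMeasurableSpace α] (p : PMF α) (g : α → ℝ) :
    ∫ a, g a ∂p.toMeasure = ∑ a, (p a).toReal * g a := by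
  simp [PMF.integral_eq_sum]

theorem PMF.integral_bind_map {α β : Type*} [Fintype α] [Fintype β]
    [MeasurableSpace α] [DiscreteMeasurableSpace α] [MeasurableSpace β] [DiscreteMeasurableSpace β]
    (p : PMF α) (q : α → PMF β) (g : α × β → ℝ) :
    ∫ x, g x ∂(p.bind fun a => (q a).map (Prod.mk a)).toMeasure =
      ∑ a, (p a).toReal * ∑ b, (q a b).toReal * g (a, b) := by
  classical
  have hb : ∀ x : α × β, (p.bind fun a => (q a).map (Prod.mk a)) x = p x.1 * q x.1 x.2 := by
    rintro ⟨a, b⟩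
    rw [PMF.bind_apply, tsum_fintype, Finset.sum_eq_single a]
    · rw [PMF.map_apply, tsum_fintype, Finset.sum_eq_single b] <;> simp +contextual
      intro b' h1 h2
      exact absurd h2.symm h1
    · intro a' _ ha'
      simp [PMF.map_apply, ha'.symm]
    · simp
  rw [PMF.integral_eq_sum_mul, Fintype.sum_prod_type]
  refine Finset.sum_congr rfl fun a _ => ?_
  rw [Finset.mul_sum]
  exact Finset.sum_congr rfl fun b _ => by rw [hb, ENNReal.toReal_mul, mul_assoc]

end

noncomputable section

namespace MDP

variable {S Act : Type*} [Fintype S] [MeasurableSpace S] [DiscreteMeasurableSpace S]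
  [Fintype Act] [MeasurableSpace Act] [DiscreteMeasurableSpace Act]

/-! ### The law of the state-action process -/

instance (M : MDP S Act) (π : Policy S Act) : IsProbabilityMeasure (M.law π) := by
  unfold law
  infer_instance

theorem integrable_comp_of_finite {Ω X : Type*} [MeasurableSpace Ω] [Finite X] [MeasurableSpace X]
    [DiscreteMeasurableSpace X] (μ : Measure Ω) [IsFiniteMeasure μ] {f : Ω → X}
    (hf : Measurable f) (g : X → ℝ) : Integrable (fun ω => g (f ω)) μ :=
  (Integrable.of_finite (μ := μ.map f) (f := g)).comp_measurable hf

theorem integrable_eval (M : MDP S Act) (π : Policy S Act) (t : ℕ) (g : S × Act → ℝ) :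
    Integrable (fun ω => g (ω t)) (M.law π) :=
  integrable_comp_of_finite _ (f := fun ω : ℕ → S × Act => ω t) (measurable_pi_apply t) g

theorem map_frestrictLe_zero_law (M : MDP S Act) (π : Policy S Act) :
    (M.law π).map (fun ω => ω 0) = (M.initLaw π).toMeasure := by
  have h : (fun ω : ℕ → S × Act => ω 0) =
      (MeasurableEquiv.piUnique (fun _ : Finset.Iic 0 => S × Act)) ∘ Preorder.frestrictLe 0 := rfl
  rw [h, ← Measure.map_map (by fun_prop) (by fun_prop), law, Kernel.trajMeasure,
    Measure.map_comp _ _ (by fun_prop), Kernel.traj_map_frestrictLe, Kernel.partialTraj_self,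
    Measure.id_comp, Measure.map_map (by fun_prop) (by fun_prop)]
  convert Measure.map_id
  ext1 x
  simp

theorem integral_eval_zero (M : MDP S Act) (π : Policy S Act) (g : S × Act → ℝ) :
    ∫ ω, g (ω 0) ∂M.law π =
      ∑ s, (M.κ₀ s).toReal * ∑ a, (π 0 (fun i => i.elim0) s a).toReal * g (s, a) := by
  rw [← PMF.integral_bind_map, ← initLaw, ← map_frestrictLe_zero_law,
    integral_map (measurable_pi_apply 0).aemeasurable
      (Measurable.of_discrete (f := g)).aestronglyMeasurable]

/-- Disintegration of the trajectory law at time `t`. The integrand sees the whole history because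
the policy may depend on it. -/
theorem integral_eval_succ (M : MDP S Act) (π : Policy S Act) (t : ℕ)
    (F : (Finset.Iic t → S × Act) × (S × Act) → ℝ) :
    ∫ ω, F (Preorder.frestrictLe t ω, ω (t + 1)) ∂M.law π =
      ∫ ω, ∫ x, F (Preorder.frestrictLe t ω, x)
        ∂(M.stepLaw π t (Preorder.frestrictLe t ω)).toMeasure ∂M.law π := by
  have h := Kernel.map_frestrictLe_trajMeasure_compProd_eq_map_trajMeasure
    (X := fun _ => S × Act) (μ₀ := (M.initLaw π).toMeasure) (κ := M.stepKernel π) (a := t)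
  have hF : AEStronglyMeasurable F
      ((M.law π).map fun ω => (Preorder.frestrictLe t ω, ω (t + 1))) :=
    (Measurable.of_discrete (f := F)).aestronglyMeasurable
  rw [← integral_map (φ := fun ω : ℕ → S × Act => (Preorder.frestrictLe t ω, ω (t + 1)))
    (by fun_prop) hF, law, ← h, Measure.integral_compProd Integrable.of_finite,
    integral_map (by fun_prop) (Measurable.of_discrete).aestronglyMeasurable]
  rfl

/-- The policy affects only the choice of `α_{t+1}`, whose probabilities sum to one, so the
dependence on the earlier history disappears. Indicators `g` give the test sets for conditioning on
`(s_t, α_t)`. -/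
theorem integral_eval_mul_state_succ (M : MDP S Act) (π : Policy S Act) (t : ℕ)
    (g : S × Act → ℝ) (v : S → ℝ) :
    ∫ ω, g (ω t) * v (ω (t + 1)).1 ∂M.law π =
      ∫ ω, g (ω t) * expectationMapping v (ω t).1 (M.T (ω t).1 (ω t).2) ∂M.law π := by
  refine (M.integral_eval_succ π t fun x => g (x.1 ⟨t, Finset.mem_Iic.2 le_rfl⟩) * v x.2.1).trans ?_
  refine integral_congr_ae (.of_forall fun ω => ?_)
  simp only [stepLaw, PMF.integral_bind_map, ← Finset.sum_mul, PMF.sum_toReal, one_mul,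
    Preorder.frestrictLe_apply, expectationMapping, Finset.mul_sum]
  exact Finset.sum_congr rfl fun s _ => by ring

theorem integral_state_succ (M : MDP S Act) (π : Policy S Act) (t : ℕ) (v : S → ℝ) :
    ∫ ω, v (ω (t + 1)).1 ∂M.law π =
      ∫ ω, expectationMapping v (ω t).1 (M.T (ω t).1 (ω t).2) ∂M.law π := by
  simpa using M.integral_eval_mul_state_succ π t 1 v

theorem integral_eval_succ_of_stationary (M : MDP S Act) {π : Policy S Act} {f : S → PMF Act}
    (hf : ∀ t h s, π t h s = f s) (t : ℕ) (g : S × Act → ℝ) :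
    ∫ ω, g (ω (t + 1)) ∂M.law π =
      ∫ ω, expectationMapping (fun s => ∑ a, (f s a).toReal * g (s, a)) (ω t).1
        (M.T (ω t).1 (ω t).2) ∂M.law π := by
  refine (M.integral_eval_succ π t fun x => g x.2).trans
    (integral_congr_ae (.of_forall fun ω => ?_))
  simp only [stepLaw, PMF.integral_bind_map, hf, Preorder.frestrictLe_apply, expectationMapping]
  exact Finset.sum_congr rfl fun s _ => mul_comm _ _

theorem comap_eval_le {X : Type*} [MeasurableSpace X] (t : ℕ) :
    MeasurableSpace.comap (fun ω : ℕ → X => ω t) inferInstance ≤ MeasurableSpace.pi :=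
  (measurable_pi_apply t).comap_le

theorem condExpStep_state_succ (M : MDP S Act) (π : Policy S Act) (t : ℕ) (v : S → ℝ) :
    M.condExpStep π t (fun ω => v (ω (t + 1)).1) =ᵐ[M.law π]
      fun ω => expectationMapping v (ω t).1 (M.T (ω t).1 (ω t).2) := by
  classical
  have hI : Integrable
      (fun ω => expectationMapping v (ω t).1 (M.T (ω t).1 (ω t).2)) (M.law π) :=
    M.integrable_eval π t fun x => expectationMapping v x.1 (M.T x.1 x.2)
  refine (ae_eq_condExp_of_forall_setIntegral_eq (comap_eval_le t)
    (M.integrable_eval π (t + 1) fun x => v x.1) (fun s _ _ => hI.integrableOn) ?_ ?_).symm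
  · rintro _ ⟨B, hB, rfl⟩ _
    have hm : MeasurableSet ((fun ω : ℕ → S × Act => ω t) ⁻¹' B) := measurable_pi_apply t hB
    rw [← integral_indicator hm, ← integral_indicator hm]
    convert (M.integral_eval_mul_state_succ π t (B.indicator 1) v).symm using 3 with ω ω
    all_goals
      by_cases h : ω t ∈ B <;> simp [h]
  · refine Measurable.aestronglyMeasurable ?_
    exact (Measurable.of_discrete (f := fun x : S × Act =>
      expectationMapping v x.1 (M.T x.1 x.2))).comp (comap_measurable _)

/-! ### The nested risk is the expected discounted cost -/

theorem integrable_condExpStep (M : MDP S Act) (π : Policy S Act) (t : ℕ)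
    (X : (ℕ → S × Act) → ℝ) : Integrable (M.condExpStep π t X) (M.law π) :=
  integrable_condExp

theorem integral_condExpStep (M : MDP S Act) (π : Policy S Act) (t : ℕ)
    (X : (ℕ → S × Act) → ℝ) : ∫ ω, M.condExpStep π t X ω ∂M.law π = ∫ ω, X ω ∂M.law π :=
  integral_condExp (comap_eval_le t)

theorem integrable_nestedTail (M : MDP S Act) (π : Policy S Act) (x : ℕ → (ℕ → S × Act) → ℝ)
    (k t : ℕ) : Integrable (nestedTail (M.condExpStep π) x k t) (M.law π) := by
  cases k <;> exact M.integrable_condExpStep π _ _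

/-- Each conditional expectation preserves the integral, so the nesting unravels without any Markov
property of the policy. -/
theorem integral_nestedTail (M : MDP S Act) (π : Policy S Act) (x : ℕ → (ℕ → S × Act) → ℝ)
    (hx : ∀ t, Integrable (x t) (M.law π)) (k t : ℕ) :
    ∫ ω, nestedTail (M.condExpStep π) x k t ω ∂M.law π =
      ∑ j ∈ Finset.range (k + 1), ∫ ω, x (t + j) ω ∂M.law π := by
  induction k generalizing t with
  | zero => simp [nestedTail, integral_condExpStep]
  | succ k ih =>
    rw [nestedTail, integral_condExpStep, integral_add (hx t) (M.integrable_nestedTail π x k _), ih,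
      Finset.sum_range_succ' _ (k + 1), add_comm]
    simp [add_comm, add_left_comm]

theorem integrable_stageCost (M : MDP S Act) (π : Policy S Act) (c : S → Act → ℝ) (t : ℕ) :
    Integrable (stageCost c t) (M.law π) :=
  M.integrable_eval π t fun x => c x.1 x.2

theorem finiteRisk_eq_sum (M : MDP S Act) (γ : ℝ) (π : Policy S Act) (c : S → Act → ℝ) (N : ℕ) :
    M.finiteRisk γ π c N =
      ∑ t ∈ Finset.range (N + 1), γ ^ t * ∫ ω, stageCost c t ω ∂M.law π := by
  cases N with
  | zero => simp [finiteRisk, discountedRisk]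
  | succ k =>
    rw [finiteRisk, discountedRisk, integral_add (M.integrable_stageCost π c 0)
      (M.integrable_nestedTail π _ k 1), integral_nestedTail _ _ _
        (fun t => (M.integrable_stageCost π c t).const_mul _), Finset.sum_range_succ' _ (k + 1),
      add_comm]
    simp [integral_const_mul, add_comm]

theorem abs_integral_eval_le (M : MDP S Act) (π : Policy S Act) (t : ℕ) (g : S × Act → ℝ) :
    |∫ ω, g (ω t) ∂M.law π| ≤ ∑ x, |g x| := by
  have := norm_integral_le_of_norm_le_const (μ := M.law π) (f := fun ω => g (ω t))
    (C := ∑ x, |g x|) (.of_forall fun ω =>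
      Finset.single_le_sum (f := fun x => |g x|) (fun x _ => abs_nonneg _) (Finset.mem_univ (ω t)))
  simpa using this

theorem tendsto_pow_mul_integral_eval (M : MDP S Act) {γ : ℝ} (hγ0 : 0 < γ) (hγ1 : γ < 1)
    (π : Policy S Act) (g : S × Act → ℝ) :
    Tendsto (fun t => γ ^ t * ∫ ω, g (ω t) ∂M.law π) atTop (𝓝 0) := by
  have h0 := (tendsto_pow_atTop_nhds_zero_of_lt_one hγ0.le hγ1).mul_const (∑ x, |g x|)
  rw [zero_mul] at h0
  refine squeeze_zero_norm (fun t => ?_) h0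
  rw [norm_mul, norm_pow, Real.norm_of_nonneg hγ0.le]
  exact mul_le_mul_of_nonneg_left (M.abs_integral_eval_le π t g) (by positivity)

theorem summable_discounted (M : MDP S Act) {γ : ℝ} (hγ0 : 0 < γ) (hγ1 : γ < 1)
    (π : Policy S Act) (c : S → Act → ℝ) :
    Summable fun t => γ ^ t * ∫ ω, stageCost c t ω ∂M.law π := by
  refine Summable.of_norm_bounded
    ((summable_geometric_of_lt_one hγ0.le hγ1).mul_right (∑ x : S × Act, |c x.1 x.2|)) fun t => ?_
  rw [norm_mul, norm_pow, Real.norm_of_nonneg hγ0.le]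
  exact mul_le_mul_of_nonneg_left (M.abs_integral_eval_le π t fun x => c x.1 x.2) (by positivity)

theorem tendsto_finiteRisk (M : MDP S Act) {γ : ℝ} (hγ0 : 0 < γ) (hγ1 : γ < 1)
    (π : Policy S Act) (c : S → Act → ℝ) :
    Tendsto (M.finiteRisk γ π c) atTop (𝓝 (M.risk γ π c)) := by
  refine tendsto_nhds_limUnder (g := M.finiteRisk γ π c)
    ⟨∑' t, γ ^ t * ∫ ω, stageCost c t ω ∂M.law π, ?_⟩
  rw [funext (M.finiteRisk_eq_sum γ π c)]
  exact (M.summable_discounted hγ0 hγ1 π c).hasSum.tendsto_sum_nat.comp (tendsto_add_atTop_nat 1)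

theorem hasSum_risk (M : MDP S Act) {γ : ℝ} (hγ0 : 0 < γ) (hγ1 : γ < 1)
    (π : Policy S Act) (c : S → Act → ℝ) :
    HasSum (fun t => γ ^ t * ∫ ω, stageCost c t ω ∂M.law π) (M.risk γ π c) := by
  have h := (M.summable_discounted hγ0 hγ1 π c).hasSum
  have h1 := h.tendsto_sum_nat.comp (tendsto_add_atTop_nat 1)
  have h2 := M.tendsto_finiteRisk hγ0 hγ1 π c
  rw [funext (M.finiteRisk_eq_sum γ π c)] at h2
  rwa [tendsto_nhds_unique h2 h1]

end MDP

end

noncomputable section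

namespace MDP

variable {S Act ι : Type*} [Fintype S] [MeasurableSpace S] [DiscreteMeasurableSpace S]
  [Fintype Act] [MeasurableSpace Act] [DiscreteMeasurableSpace Act] [Fintype ι]

/-! ### Weak duality -/

/-- The expectation of the initial state under a policy does not depend on the policy. -/
theorem integral_state_zero (M : MDP S Act) (π : Policy S Act) (v : S → ℝ) :
    ∫ ω, v (ω 0).1 ∂M.law π = ∑ s, (M.κ₀ s).toReal * v s := by
  rw [M.integral_eval_zero π fun x => v x.1]
  simp only [← Finset.sum_mul, PMF.sum_toReal, one_mul]

/-- A subsolution of the Bellman equation is a lower bound for the risk of every policy. -/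
theorem sum_le_risk_of_le_bellman (M : MDP S Act) {γ : ℝ} (hγ0 : 0 < γ) (hγ1 : γ < 1)
    (π : Policy S Act) {c : S → Act → ℝ} {V : S → ℝ}
    (hV : ∀ s a, V s ≤ c s a + γ * expectationMapping V s (M.T s a)) :
    ∑ s, (M.κ₀ s).toReal * V s ≤ M.risk γ π c := by
  have step : ∀ t, ∫ ω, V (ω t).1 ∂M.law π ≤
      ∫ ω, stageCost c t ω ∂M.law π + γ * ∫ ω, V (ω (t + 1)).1 ∂M.law π := by
    intro t
    have hE : Integrable (fun ω => γ * expectationMapping V (ω t).1 (M.T (ω t).1 (ω t).2))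
        (M.law π) := M.integrable_eval π t fun x => γ * expectationMapping V x.1 (M.T x.1 x.2)
    rw [M.integral_state_succ, ← integral_const_mul,
      ← integral_add (M.integrable_stageCost π c t) hE]
    exact integral_mono (M.integrable_eval π t fun x => V x.1)
      ((M.integrable_stageCost π c t).add hE) fun ω => hV _ _
  -- The inequalities `step t`, weighted by `γ ^ t`, telescope; the remainder tends to zero because
  -- `V` is bounded.
  have bound : ∀ N, ∑ s, (M.κ₀ s).toReal * V s ≤
      ∑ t ∈ Finset.range N, γ ^ t * ∫ ω, stageCost c t ω ∂M.law π +
        γ ^ N * ∫ ω, V (ω N).1 ∂M.law π := by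
    intro N
    induction N with
    | zero => simp [integral_state_zero]
    | succ N ih =>
      refine ih.trans ?_
      have := mul_le_mul_of_nonneg_left (step N) (pow_nonneg hγ0.le N)
      rw [Finset.sum_range_succ, pow_succ]
      linarith
  have lim := (M.hasSum_risk hγ0 hγ1 π c).tendsto_sum_nat.add
    (M.tendsto_pow_mul_integral_eval hγ0 hγ1 π fun x => V x.1)
  rw [add_zero] at lim
  exact ge_of_tendsto' lim bound

theorem risk_add_sum (M : MDP S Act) {γ : ℝ} (hγ0 : 0 < γ) (hγ1 : γ < 1) (π : Policy S Act)
    (c : S → Act → ℝ) (d : ι → S → Act → ℝ) (l : ι → ℝ) :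
    M.risk γ π (fun s a => c s a + ∑ i, l i * d i s a) =
      M.risk γ π c + ∑ i, l i * M.risk γ π (d i) := by
  refine (M.hasSum_risk hγ0 hγ1 π _).unique ?_
  convert (M.hasSum_risk hγ0 hγ1 π c).add
    (hasSum_sum fun i _ => (M.hasSum_risk hγ0 hγ1 π (d i)).mul_left (l i)) using 2 with t
  have h : ∀ ω : ℕ → S × Act, stageCost (fun s a => c s a + ∑ i, l i * d i s a) t ω =
      stageCost c t ω + ∑ i, l i * stageCost (d i) t ω := fun ω => rfl
  simp_rw [h]
  rw [integral_add (M.integrable_stageCost π c t)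
      (integrable_finsetSum _ fun i _ => (M.integrable_stageCost π (d i) t).const_mul _),
    integral_finsetSum _ fun i _ => (M.integrable_stageCost π (d i) t).const_mul _,
    mul_add, Finset.mul_sum]
  congr 1
  refine Finset.sum_congr rfl fun i _ => ?_
  rw [integral_const_mul]
  ring

/-! ### Occupation measures and stationary policies -/

/-- A nonnegative solution of the flow equation disintegrates into its state marginal and a
stationary decision rule. -/
theorem exists_decisionRule_of_flow (M : MDP S Act) {γ : ℝ} {μ : S × Act → ℝ} (hμ : ∀ x, 0 ≤ μ x)
    (hflow : ∀ V : S → ℝ, ∑ s, (M.κ₀ s).toReal * V s =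
      ∑ x, μ x * (V x.1 - γ * expectationMapping V x.1 (M.T x.1 x.2))) :
    ∃ f : S → PMF Act, ∀ s a, μ (s, a) = (∑ b, μ (s, b)) * (f s a).toReal := by
  -- With no actions, the flow equation at `V = 1` would read `1 = 0`.
  have hAct : Nonempty Act := by
    by_contra h
    rw [not_nonempty_iff] at h
    have := hflow 1
    simp [PMF.sum_toReal] at this
  have h : ∀ s, ∃ p : PMF Act, ∀ a, μ (s, a) = (∑ b, μ (s, b)) * (p a).toReal := by
    intro s
    have h0 : ∀ a, 0 ≤ μ (s, a) := fun a => hμ _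
    rcases (Finset.sum_nonneg fun a _ => h0 a : 0 ≤ ∑ b, μ (s, b)).eq_or_lt with hm | hm
    -- At a state of zero mass any distribution serves.
    · refine ⟨PMF.pure hAct.some, fun a => ?_⟩
      rw [← hm, zero_mul]
      exact (Finset.sum_eq_zero_iff_of_nonneg fun a _ => h0 a).1 hm.symm a (Finset.mem_univ a)
    · refine ⟨PMF.ofFintype (fun a => ENNReal.ofReal (μ (s, a) / ∑ b, μ (s, b))) ?_, fun a => ?_⟩
      · rw [← ENNReal.ofReal_sum_of_nonneg fun a _ => div_nonneg (h0 a) hm.le, ← Finset.sum_div,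
          div_self hm.ne', ENNReal.ofReal_one]
      · rw [PMF.ofFintype_apply, ENNReal.toReal_ofReal (div_nonneg (h0 a) hm.le),
          mul_div_cancel₀ _ hm.ne']
  choose f hf using h
  exact ⟨f, hf⟩

/-- The stationary policy induced by an occupation measure has at most the risk that the
occupation measure predicts. -/
theorem risk_le_of_flow (M : MDP S Act) {γ : ℝ} (hγ0 : 0 < γ) (hγ1 : γ < 1) {μ : S × Act → ℝ}
    (hμ : ∀ x, 0 ≤ μ x)
    (hflow : ∀ V : S → ℝ, ∑ s, (M.κ₀ s).toReal * V s =
      ∑ x, μ x * (V x.1 - γ * expectationMapping V x.1 (M.T x.1 x.2)))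
    {f : S → PMF Act} (hf : ∀ s a, μ (s, a) = (∑ b, μ (s, b)) * (f s a).toReal)
    {π : Policy S Act} (hπ : ∀ t h s, π t h s = f s)
    {g : S → Act → ℝ} (hg : ∀ s a, 0 ≤ g s a) :
    M.risk γ π g ≤ ∑ x, μ x * g x.1 x.2 := by
  -- The cost `g` must vary in the induction: peeling off time `0` replaces it by `Pg`, its expected
  -- value one step later under `f`.
  have bound : ∀ (N : ℕ) (g : S × Act → ℝ), (∀ x, 0 ≤ g x) →
      ∑ t ∈ Finset.range N, γ ^ t * ∫ ω, g (ω t) ∂M.law π ≤ ∑ x, μ x * g x := by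
    intro N
    induction N with
    | zero =>
      intro g hg
      rw [Finset.sum_range_zero]
      exact Finset.sum_nonneg fun x _ => mul_nonneg (hμ x) (hg x)
    | succ N ih =>
      intro g hg
      set v : S → ℝ := fun s => ∑ a, (f s a).toReal * g (s, a) with hv
      set Pg : S × Act → ℝ := fun x => expectationMapping v x.1 (M.T x.1 x.2) with hPg
      have hv0 : ∀ s, 0 ≤ v s := fun s =>
        Finset.sum_nonneg fun a _ => mul_nonneg ENNReal.toReal_nonneg (hg _)
      have hPg0 : ∀ x, 0 ≤ Pg x := fun x =>
        Finset.sum_nonneg fun s _ => mul_nonneg (hv0 s) ENNReal.toReal_nonneg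
      -- The flow equation tested on `v`, the cost averaged over actions.
      have h0 : ∫ ω, g (ω 0) ∂M.law π = ∑ x, μ x * v x.1 - γ * ∑ x, μ x * Pg x := by
        rw [M.integral_eval_zero]
        simp only [hπ]
        rw [hflow v, Finset.mul_sum, ← Finset.sum_sub_distrib]
        exact Finset.sum_congr rfl fun x _ => by ring
      have hmarg : ∑ x, μ x * v x.1 = ∑ x, μ x * g x := by
        rw [Fintype.sum_prod_type, Fintype.sum_prod_type]
        refine Finset.sum_congr rfl fun s _ => ?_
        change ∑ a, μ (s, a) * v s = _
        rw [← Finset.sum_mul, hv, Finset.mul_sum]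
        refine Finset.sum_congr rfl fun a _ => ?_
        rw [← mul_assoc, ← hf]
      have hstep : ∑ t ∈ Finset.range N, γ ^ (t + 1) * ∫ ω, g (ω (t + 1)) ∂M.law π =
          γ * ∑ t ∈ Finset.range N, γ ^ t * ∫ ω, Pg (ω t) ∂M.law π := by
        rw [Finset.mul_sum]
        refine Finset.sum_congr rfl fun t _ => ?_
        rw [M.integral_eval_succ_of_stationary hπ, pow_succ]
        ring
      rw [Finset.sum_range_succ', hstep, h0, hmarg, pow_zero, one_mul]
      linarith [mul_le_mul_of_nonneg_left (ih Pg hPg0) hγ0.le]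
  exact le_of_tendsto' (M.hasSum_risk hγ0 hγ1 π g).tendsto_sum_nat fun N =>
    bound N (fun x => g x.1 x.2) fun x => hg _ _

/-! ### The linear program -/

/-- `v ↦ σ(v, s, p)` as a linear form. -/
def expectationForm (p : PMF S) : (S → ℝ) →ₗ[ℝ] ℝ :=
  ∑ s, (p s).toReal • LinearMap.proj s

theorem expectationForm_apply (p : PMF S) (v : S → ℝ) :
    expectationForm p v = ∑ s, (p s).toReal * v s := by
  simp [expectationForm]

theorem expectationMapping_eq_expectationForm (v : S → ℝ) (s : S) (p : PMF S) :
    expectationMapping v s p = expectationForm p v := by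
  rw [expectationForm_apply, expectationMapping]
  exact Finset.sum_congr rfl fun _ _ => mul_comm _ _

/-- `l ↦ ⟨l, b⟩` as a linear form. -/
def pairingForm (b : ι → ℝ) : (ι → ℝ) →ₗ[ℝ] ℝ :=
  ∑ i, b i • LinearMap.proj i

theorem pairingForm_apply (b l : ι → ℝ) : pairingForm b l = ∑ i, l i * b i := by
  simp [pairingForm, mul_comm]

/-- The objective of the linear program. -/
def objectiveForm (M : MDP S Act) (β : ι → ℝ) : (S → ℝ) × (ι → ℝ) →ₗ[ℝ] ℝ :=
  (expectationForm M.κ₀).comp (LinearMap.fst ℝ _ _) - (pairingForm β).comp (LinearMap.snd ℝ _ _)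

theorem objectiveForm_apply (M : MDP S Act) (β : ι → ℝ) (x : (S → ℝ) × (ι → ℝ)) :
    M.objectiveForm β x = ∑ s, (M.κ₀ s).toReal * x.1 s - ∑ i, x.2 i * β i := by
  simp [objectiveForm, expectationForm_apply, pairingForm_apply]

/-- The linear parts of the constraints of the linear program. -/
def constraintForm (M : MDP S Act) (γ : ℝ) (d : ι → S → Act → ℝ) :
    (S × Act) ⊕ ι → (S → ℝ) × (ι → ℝ) →ₗ[ℝ] ℝ
  | .inl k => (LinearMap.proj k.1 - γ • expectationForm (M.T k.1 k.2)).comp (LinearMap.fst ℝ _ _)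
      - (pairingForm fun i => d i k.1 k.2).comp (LinearMap.snd ℝ _ _)
  | .inr i => -(LinearMap.proj i).comp (LinearMap.snd ℝ _ _)

/-- Normal form for duality: all variables on the left, constants on the right. -/
theorem mem_feasibleSet_bellmanProgram_iff (M : MDP S Act) (γ : ℝ) (c : S → Act → ℝ)
    (d : ι → S → Act → ℝ) (β : ι → ℝ) (x : (S → ℝ) × (ι → ℝ)) :
    x ∈ (M.bellmanProgram γ c d β expectationMapping).feasibleSet ↔
      ∀ k, M.constraintForm γ d k x ≤ Sum.elim (fun k => c k.1 k.2) 0 k := by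
  refine forall_congr' fun k => ?_
  rcases k with k | i
  · simp only [bellmanProgram, constraintForm, expectationMapping_eq_expectationForm,
      LinearMap.sub_apply, LinearMap.comp_apply, LinearMap.fst_apply, LinearMap.snd_apply,
      LinearMap.proj_apply, LinearMap.smul_apply, pairingForm_apply, smul_eq_mul, Sum.elim_inl]
    constructor <;> intro h <;> linarith
  · simp [bellmanProgram, constraintForm]

theorem isLinear_bellmanProgram (M : MDP S Act) (γ : ℝ) (c : S → Act → ℝ)
    (d : ι → S → Act → ℝ) (β : ι → ℝ) :
    (M.bellmanProgram γ c d β expectationMapping).IsLinear := by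
  refine ⟨inferInstance, inferInstance, ⟨M.objectiveForm β, fun x => ?_⟩, fun k => ?_⟩
  · rw [objectiveForm_apply]; rfl
  · rcases k with k | i
    · refine ⟨⟨((LinearMap.proj k.1).comp (LinearMap.fst ℝ _ _)).toAffineMap, fun x => rfl⟩,
        ⟨AffineMap.const ℝ _ (c k.1 k.2) +
          ((pairingForm fun i => d i k.1 k.2).comp (LinearMap.snd ℝ _ _)).toAffineMap +
          ((γ • expectationForm (M.T k.1 k.2)).comp (LinearMap.fst ℝ _ _)).toAffineMap,
          fun x => ?_⟩⟩
      simp [bellmanProgram, expectationMapping_eq_expectationForm, pairingForm_apply]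
    · exact ⟨⟨0, fun x => rfl⟩,
        ⟨((LinearMap.proj i).comp (LinearMap.snd ℝ _ _)).toAffineMap, fun x => rfl⟩⟩

/-- A solution of the linear program yields an occupation measure which satisfies the budget
constraints and whose cost is at most the optimal value. -/
theorem exists_occupationMeasure_of_isSolution (M : MDP S Act) (γ : ℝ) (c : S → Act → ℝ)
    (d : ι → S → Act → ℝ) (β : ι → ℝ) {V : S → ℝ} {l : ι → ℝ}
    (h : (M.bellmanProgram γ c d β expectationMapping).IsSolution (V, l)) :
    ∃ μ : S × Act → ℝ, (∀ x, 0 ≤ μ x) ∧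
      (∀ V : S → ℝ, ∑ s, (M.κ₀ s).toReal * V s =
        ∑ x, μ x * (V x.1 - γ * expectationMapping V x.1 (M.T x.1 x.2))) ∧
      (∀ i, ∑ x, μ x * d i x.1 x.2 ≤ β i) ∧
      ∑ x, μ x * c x.1 x.2 ≤ ∑ s, (M.κ₀ s).toReal * V s - ∑ i, l i * β i := by
  classical
  obtain ⟨u, hu, hf, hval⟩ := exists_multipliers_of_isMax (M.objectiveForm β)
    (M.constraintForm γ d) (Sum.elim (fun k => c k.1 k.2) 0) (V, l)
    ((M.mem_feasibleSet_bellmanProgram_iff γ c d β _).1 h.1) (fun x hx => by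
      have := h.2 x ((M.mem_feasibleSet_bellmanProgram_iff γ c d β x).2 hx)
      rwa [objectiveForm_apply, objectiveForm_apply])
  refine ⟨fun x => u (.inl x), fun x => hu _, fun W => ?_, fun i => ?_, ?_⟩
  -- Comparing the `V` components of the multiplier identity gives the flow equation.
  · have := hf (W, 0)
    rw [objectiveForm_apply] at this
    simpa [constraintForm, expectationMapping_eq_expectationForm] using this
  -- Comparing the coefficients of `l i` shows that the multiplier of `0 ≤ l i` is the slack in
  -- budget `i`.
  · have := hf (0, Pi.single i 1)
    rw [objectiveForm_apply] at this
    simp [constraintForm, pairingForm_apply, Pi.single_apply] at this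
    linarith [hu (.inr i)]
  · rw [objectiveForm_apply] at hval
    simpa using hval

theorem optimalValue_eq_of_isSolution (M : MDP S Act) {γ : ℝ} (hγ0 : 0 < γ) (hγ1 : γ < 1)
    {c : S → Act → ℝ} (hc : ∀ s a, 0 ≤ c s a) {d : ι → S → Act → ℝ} (hd : ∀ i s a, 0 ≤ d i s a)
    (β : ι → ℝ) {Pol : Set (Policy S Act)} (hPol : ∀ π : Policy S Act, π.IsStationary → π ∈ Pol)
    {V : S → ℝ} {l : ι → ℝ}
    (h : (M.bellmanProgram γ c d β expectationMapping).IsSolution (V, l)) :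
    M.optimalValue γ c d β Pol =
      ((∑ s, (M.κ₀ s).toReal * V s - ∑ i, l i * β i : ℝ) : EReal) := by
  refine le_antisymm ?_ ?_
  · obtain ⟨μ, hμ, hflow, hbudget, hcost⟩ := M.exists_occupationMeasure_of_isSolution γ c d β h
    obtain ⟨f, hf⟩ := M.exists_decisionRule_of_flow hμ hflow
    let π : Policy S Act := fun _ _ s => f s
    have hle : ∀ {g : S → Act → ℝ}, (∀ s a, 0 ≤ g s a) →
        M.risk γ π g ≤ ∑ x, μ x * g x.1 x.2 := fun hg =>
      M.risk_le_of_flow hγ0 hγ1 hμ hflow hf (fun _ _ _ => rfl) hg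
    refine iInf₂_le_of_le π ⟨hPol π ⟨f, fun _ _ _ => rfl⟩, fun i => ?_⟩ ?_
    · exact (hle (hd i)).trans (hbudget i)
    · exact EReal.coe_le_coe_iff.2 ((hle hc).trans hcost)
  · refine le_iInf₂ fun π hπ => EReal.coe_le_coe_iff.2 ?_
    -- The Bellman constraints are the subsolution inequality for the Lagrangian cost.
    have hV := M.sum_le_risk_of_le_bellman hγ0 hγ1 π
      (c := fun s a => c s a + ∑ i, l i * d i s a) fun s a => h.1 (.inl (s, a))
    rw [M.risk_add_sum hγ0 hγ1] at hV
    have hl : ∑ i, l i * M.risk γ π (d i) ≤ ∑ i, l i * β i :=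
      Finset.sum_le_sum fun i _ => mul_le_mul_of_nonneg_left (hπ.2 i) (h.1 (.inr i))
    linarith

end MDP

end

theorem corollary1 {S Act ι : Type*}
    [Fintype S] [MeasurableSpace S] [DiscreteMeasurableSpace S]
    [Fintype Act] [MeasurableSpace Act] [DiscreteMeasurableSpace Act] [Fintype ι]
    (M : MDP S Act) (γ : ℝ) (hγ0 : 0 < γ) (hγ1 : γ < 1)
    (c : S → Act → ℝ) (hc : ∀ s α, 0 ≤ c s α)
    (d : ι → S → Act → ℝ) (hd : ∀ i s α, 0 ≤ d i s α)
    (β : ι → ℝ) (hβ : ∀ i, 0 < β i)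
    -- any class of policies that contains the stationary ones, e.g. all policies
    (Pol : Set (Policy S Act)) (hPol : ∀ π : Policy S Act, π.IsStationary → π ∈ Pol) :
    -- the limits that define `J_γ(κ₀, π)` and `D^i_γ(κ₀, π)` exist
    (∀ π : Policy S Act,
      Tendsto (M.finiteRisk γ π c) atTop (𝓝 (M.risk γ π c)) ∧
      ∀ i, Tendsto (M.finiteRisk γ π (d i)) atTop (𝓝 (M.risk γ π (d i)))) ∧
    -- the mapping in the optimization problem is the risk transition mapping of `𝔼[· | s_t, α_t]`
    (∀ (π : Policy S Act) (t : ℕ) (v : S → ℝ),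
      M.condExpStep π t (fun ω => v (ω (t + 1)).1) =ᵐ[M.law π]
        fun ω => MDP.expectationMapping v (ω t).1 (M.T (ω t).1 (ω t).2)) ∧
    -- every solution attains the value of the constrained problem
    (∀ (V : S → ℝ) (l : ι → ℝ),
      (M.bellmanProgram γ c d β MDP.expectationMapping).IsSolution (V, l) →
      M.optimalValue γ c d β Pol =
        ((∑ s, (M.κ₀ s).toReal * V s - ∑ i, l i * β i : ℝ) : EReal)) ∧
    -- the optimization problem is a linear program
    (M.bellmanProgram γ c d β MDP.expectationMapping).IsLinear := by
  exact ⟨fun π => ⟨M.tendsto_finiteRisk hγ0 hγ1 π c, fun i => M.tendsto_finiteRisk hγ0 hγ1 π (d i)⟩,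
    M.condExpStep_state_succ, fun _ _ h => M.optimalValue_eq_of_isSolution hγ0 hγ1 hc hd β hPol h,
    M.isLinear_bellmanProgram γ c d β⟩
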